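/- Let $q=e^{2\pi i\tau}$ with $\operatorname{Im}\tau>0$. For integers $0<g<\delta$ let $$\eta_{\delta;g}(\tau)=q^{\frac{\delta}{2}P_2(g/\delta)}\prod_{\substack{m>0\\ m\equiv g\,(\delta)}}(1-q^m)\prod_{\substack{m>0\\ m\equiv -g\,(\delta)}}(1-q^m),\qquad P_2(t)=\{t\}^2-\{t\}+\tfrac16,$$ where $\{t\}$ is the fractional part of $t$. A generalized eta-product is a function $\prod_{\delta\mid M,\;0<g<\delta}\eta_{\delta;g}(\tau)^{r_{\delta,g}}$ for some positive integer $M$, where $r_{\delta,g}\in\mathbb{Z}$ if $g\ne\delta/2$ and $r_{\delta,g}\in\frac12\mathbb{Z}$ if $g=\delta/2$. (In the latter case $\eta_{\delta;g}^{1/2}=q^{\frac{\delta}{4}P_2(1/2)}\prod_{m>0,\;m\equiv g\,(\delta)}(1-q^m)$.) Let $N$ be a positive integer. A modular function on $\Gamma_1(N)$ is a $\Gamma_1(N)$-invariant function that is meromorphic on the upper half plane and at all cusps. For a cusp $s=A\infty\in\mathbb{Q}\cup\{\infty\}$ with $A\in\mathrm{SL}_2(\mathbb{Z})$, let the fan width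 $\kappa$ be the least positive integer $h$ with $\pm A\begin{pmatrix}1&h\\0&1\end{pmatrix}A^{-1}\in\Gamma_1(N)$ for some choice of sign. For a modular function $f$ on $\Gamma_1(N)$, let $\mathrm{ORD}(f,s,\Gamma_1(N))$ be the least exponent $k$ with $a_k\neq0$ in the expansion $f(A\tau)=\sum_k a_k e^{2\pi i k\tau/\kappa}$ (valid for $\operatorname{Im}\tau$ large), and $+\infty$ if $f\equiv 0$; that is, $\kappa$ times the order of $f(A\tau)$ in $q$. Let $n\ge 0$, let $f_1,\dots,f_n$ be generalized eta-products that are modular functions on $\Gamma_1(N)$, and let $\mathcal{S}_N\subset\mathbb{Q}\cup\{\infty\}$ be a complete set of inequivalent cusps for $\Gamma_1(N)$. Put $$B=\sum_{\substack{s\in\mathcal{S}_N\\ s\not\sim\infty}}\min\bigl(\{\mathrm{ORD}(f_j,s,\Gamma_1(N)) : 1\le j\le n\}\cup\{0\}\bigr),$$ where $s\not\sim\infty$ means that $s$ is not $\Gamma_1(N)$-equivalent to $\infty$. Let $\alpha_1,\dots,\alpha_n\in\mathbb{C}$ and $$g(\tau)=\alpha_1f_1(\tau)+\dots+\alpha_nf_n(\tau)+1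 .$$ Then $g\equiv 0$ if and only if $\mathrm{ORD}(g,\infty,\Gamma_1(N))>-B$. -/

import Mathlib

open scoped MatrixGroups

noncomputable section

namespace GenEta

open UpperHalfPlane

/-- The nome `q = exp (2 π i τ)`. -/
def nome (τ : ℍ) : ℂ := Complex.exp (2 * Real.pi * Complex.I * τ)

/-- The second periodic Bernoulli polynomial `P₂(t) = {t}² - {t} + 1/6`. -/
def P₂ (t : ℝ) : ℝ := Int.fract t ^ 2 - Int.fract t + 1 / 6

/-- The generalized Dedekind eta function, for `0 < g < δ`,
`η_{δ;g}(τ) = q^{(δ/2) P₂(g/δ)} ∏_{m > 0, m ≡ g (δ)} (1 - q^m) ∏_{m > 0, m ≡ -g (δ)} (1 - q^m)`.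
When `g = δ/2` every `m ≡ g ≡ -g` contributes twice, as is forced by
`η_{δ;g} = θ_{δ;g} / η(δτ)`. -/
def genEta (δ g : ℕ) (τ : ℍ) : ℂ :=
  Complex.exp (2 * Real.pi * Complex.I * ((δ / 2 * P₂ (g / δ) : ℝ) : ℂ) * τ) *
    ∏' n : ℕ, ((1 - nome τ ^ (δ * n + g)) * (1 - nome τ ^ (δ * n + (δ - g))))

/-- The square root of `η_{δ;g}` in the case `g = δ/2`, with the branch read off from the product:
`q^{(δ/4) P₂(g/δ)} ∏_{m > 0, m ≡ g (δ)} (1 - q^m)`. -/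
def genEtaSqrt (δ g : ℕ) (τ : ℍ) : ℂ :=
  Complex.exp (2 * Real.pi * Complex.I * ((δ / 4 * P₂ (g / δ) : ℝ) : ℂ) * τ) *
    ∏' n : ℕ, (1 - nome τ ^ (δ * n + g))

lemma genEtaSqrt_sq (δ g : ℕ) (hg : 0 < g) (h : 2 * g = δ) (τ : ℍ) :
    genEtaSqrt δ g τ ^ 2 = genEta δ g τ := by
  have hsub : δ - g = g := by omega
  have hq : ‖nome τ‖ < 1 := by
    have := UpperHalfPlane.norm_exp_two_pi_I_lt_one τ
    simpa [nome] using this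
  have hδ : 0 < δ := by omega
  have hm : Multipliable fun n : ℕ => 1 - nome τ ^ (δ * n + g) := by
    have hs : Summable fun n : ℕ => ‖-nome τ ^ (δ * n + g)‖ := by
      refine Summable.of_nonneg_of_le (fun _ => norm_nonneg _) (fun n => ?_)
        (summable_geometric_of_lt_one (norm_nonneg (nome τ)) hq)
      rw [norm_neg, norm_pow]
      exact pow_le_pow_of_le_one (norm_nonneg _) hq.le (by nlinarith)
    simpa [sub_eq_add_neg] using multipliable_one_add_of_summable hs
  unfold genEtaSqrt genEta
  rw [hsub, mul_pow, ← hm.tprod_pow, ← Complex.exp_nat_mul]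
  congr 1
  · congr 1
    push_cast
    ring
  · simp only [sq]

/-- The generalized eta-product `∏_{δ ∣ M, 0 < g < δ} η_{δ;g}(τ)^{r_{δ,g}}` of level `M`, where
`r_{δ,g} = k δ g / 2` if `g = δ/2` and `r_{δ,g} = k δ g` otherwise, the `k δ g` being integers. -/
def genEtaProduct (M : ℕ) (k : ℕ → ℕ → ℤ) (τ : ℍ) : ℂ :=
  ∏ δ ∈ M.divisors, ∏ g ∈ Finset.Ioo 0 δ,
    if 2 * g = δ then genEtaSqrt δ g τ ^ k δ g else genEta δ g τ ^ k δ g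

/-- `f` is a generalized eta-product (of some level). -/
def IsGenEtaProduct (f : ℍ → ℂ) : Prop :=
  ∃ M : ℕ, 0 < M ∧ ∃ k : ℕ → ℕ → ℤ, f = genEtaProduct M k

/-- The fan width of the cusp `A ∞` with respect to `Γ`: the least `h > 0` such that
`± A [1, h; 0, 1] A⁻¹ ∈ Γ`. -/
def fanWidth (Γ : Subgroup SL(2, ℤ)) (A : SL(2, ℤ)) : ℕ :=
  sInf {h : ℕ | 0 < h ∧
    (A * ModularGroup.T ^ h * A⁻¹ ∈ Γ ∨ -(A * ModularGroup.T ^ h * A⁻¹) ∈ Γ)}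

/-- The function `F` of the local parameter `q_κ = exp (2 π i τ / κ)`, `κ` the fan width of `A ∞`,
with `f (A τ) = F (q_κ)`. -/
def expansionAt (Γ : Subgroup SL(2, ℤ)) (f : ℍ → ℂ) (A : SL(2, ℤ)) : ℂ → ℂ :=
  Function.Periodic.cuspFunction (fanWidth Γ A) fun z : ℂ => f (A • ofComplex z)

/-- Modular functions (meromorphic modular forms of weight `0`) on `Γ`: meromorphic on `ℍ`,
invariant under `Γ`, and meromorphic at every cusp `A ∞`, `A ∈ SL(2, ℤ)`. -/
structure IsModularFunction (Γ : Subgroup SL(2, ℤ)) (f : ℍ → ℂ) : Prop where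
  meromorphicOn : MeromorphicOn (fun z : ℂ => f (ofComplex z)) {z : ℂ | 0 < z.im}
  invariant : ∀ γ ∈ Γ, ∀ τ : ℍ, f (γ • τ) = f τ
  meromorphicAtCusps : ∀ A : SL(2, ℤ), MeromorphicAt (expansionAt Γ f A) 0

/-- An element of `SL(2, ℤ)` that maps `∞` to the cusp `s ∈ ℚ ∪ {∞}`. -/
def cuspMatrix (s : OnePoint ℚ) : SL(2, ℤ) := (s.exists_mem_SL2 ℤ).choose

/-- `ORD(f, s, Γ)`: the order of `f` at the cusp `s = A ∞`, measured in the local parameter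
`q_κ = exp (2 π i τ / κ)` of `f (A τ)`, i.e. `κ` times the order in `q`, where `κ` is the fan
width of `s`. It is `⊤` when `f` vanishes identically. -/
def ORD (f : ℍ → ℂ) (s : OnePoint ℚ) (Γ : Subgroup SL(2, ℤ)) : WithTop ℤ :=
  meromorphicOrderAt (expansionAt Γ f (cuspMatrix s)) 0

/-- Equivalence of cusps in `ℚ ∪ {∞}` under `Γ`. -/
def CuspEquiv (Γ : Subgroup SL(2, ℤ)) (s t : OnePoint ℚ) : Prop :=
  ∃ γ ∈ Γ, Matrix.SpecialLinearGroup.mapGL ℚ γ • s = t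

/-- `S` is a complete set of inequivalent cusps for `Γ`. -/
def IsCompleteSetOfCusps (Γ : Subgroup SL(2, ℤ)) (S : Finset (OnePoint ℚ)) : Prop :=
  ∀ c : OnePoint ℚ, ∃! s, s ∈ S ∧ CuspEquiv Γ c s

open scoped Classical in
/-- `B = ∑ min ({ORD(f_j, s, Γ) : j} ∪ {0})`, over the cusps `s ∈ S` other than (the
representative of) `∞`. The minimum is at most `0`, hence a finite integer. -/
def boundB {n : ℕ} (Γ : Subgroup SL(2, ℤ)) (S : Finset (OnePoint ℚ)) (f : Fin n → ℍ → ℂ) : ℤ :=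
  ∑ s ∈ S with ¬ CuspEquiv Γ s OnePoint.infty,
    (min (Finset.univ.inf fun j => ORD (f j) s Γ) 0).untopD 0

end GenEta

end

namespace GenEta

open UpperHalfPlane Filter Topology Asymptotics ModularGroup
open scoped Manifold
open Matrix.SpecialLinearGroup (mapGL)
open Function.Periodic (qParam)

/-! A nonzero modular function without poles in `ℍ` cannot have positive total order at the cusps.
Generalized eta-products enter only through holomorphy on `ℍ`: their factors are zero-free, so
negative exponents are harmless. At a cusp not equivalent to `∞`, `g` has order at least the
corresponding term of `B`, the `0` in the minimum accounting for the constant `1`. Order greater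
than `-B` at `∞` then makes the total positive and forces `g = 0`.

The valence inequality `eq_zero_of_sum_order_pos` is proved by taking a norm down to level one: the
product `F` of the translates of `h` over `SL(2, ℤ) / ±Γ` is holomorphic and `SL(2, ℤ)`-invariant.
By `bijective_cusp_cosets` a cusp of width `κ` supplies `κ` translates, each of order at least `m s
/ κ` in `q`, so `F` has order at least `∑ m s > 0`. Thus `F` vanishes at `i∞`, hence identically,
and so does one translate of `h`. -/

/-! ### Holomorphy of generalized eta-products on the upper half plane -/

lemma norm_nome_lt_one (τ : ℍ) : ‖nome τ‖ < 1 := by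
  simpa [nome] using UpperHalfPlane.norm_exp_two_pi_I_lt_one τ

lemma summable_norm_pow_mul_add {q : ℂ} (hq : ‖q‖ < 1) {δ : ℕ} (hδ : 0 < δ) (a : ℕ) :
    Summable fun n : ℕ => ‖-q ^ (δ * n + a)‖ := by
  refine Summable.of_nonneg_of_le (fun _ => norm_nonneg _) (fun n => ?_)
    (summable_geometric_of_lt_one (norm_nonneg q) hq)
  rw [norm_neg, norm_pow]
  exact pow_le_pow_of_le_one (norm_nonneg _) hq.le (by nlinarith)

lemma multipliable_one_sub_pow_mul_add {q : ℂ} (hq : ‖q‖ < 1) {δ : ℕ} (hδ : 0 < δ) (a : ℕ) :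
    Multipliable fun n : ℕ => 1 - q ^ (δ * n + a) := by
  simpa [sub_eq_add_neg] using
    multipliable_one_add_of_summable (summable_norm_pow_mul_add hq hδ a)

lemma tprod_one_sub_pow_mul_add_ne_zero {q : ℂ} (hq : ‖q‖ < 1) {δ : ℕ} (hδ : 0 < δ) {a : ℕ}
    (ha : 0 < a) : ∏' n : ℕ, (1 - q ^ (δ * n + a)) ≠ 0 := by
  simp_rw [sub_eq_add_neg]
  refine tprod_one_add_ne_zero_of_summable (fun n h => ?_) (summable_norm_pow_mul_add hq hδ a)
  have h1 : q ^ (δ * n + a) = 1 := by linear_combination -h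
  have h2 : ‖q‖ ^ (δ * n + a) < 1 := pow_lt_one₀ (norm_nonneg _) hq (by omega)
  rw [← norm_pow, h1, norm_one] at h2
  exact lt_irrefl _ h2

/-- On a compact subset of the disc, the powers at a point of maximal modulus give a summable
majorant, so the product converges locally uniformly. -/
lemma differentiableOn_tprod_one_sub_pow_mul_add {δ : ℕ} (hδ : 0 < δ) (a : ℕ) :
    DifferentiableOn ℂ (fun q : ℂ => ∏' n : ℕ, (1 - q ^ (δ * n + a))) (Metric.ball 0 1) := by
  have key : MultipliableLocallyUniformlyOn (fun (n : ℕ) (q : ℂ) => 1 - q ^ (δ * n + a))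
      (Metric.ball (0 : ℂ) 1) := by
    use fun q ↦ ∏' n, (1 - q ^ (δ * n + a))
    simp_rw [sub_eq_add_neg]
    apply hasProdLocallyUniformlyOn_of_forall_compact Metric.isOpen_ball
    intro K hK hcK
    rcases K.eq_empty_or_nonempty with hN | hN
    · simpa [hasProdUniformlyOn_iff_tendstoUniformlyOn, hN] using tendstoUniformlyOn_empty
    · obtain ⟨q₀, hq₀, _, HB⟩ := hcK.exists_sSup_image_eq_and_ge hN
        (show ContinuousOn (fun q : ℂ ↦ ‖q‖) K by fun_prop)
      have hq₀' : ‖q₀‖ < 1 := by simpa [Metric.mem_ball, dist_zero_right] using hK hq₀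
      refine (summable_norm_pow_mul_add hq₀' hδ a).hasProdUniformlyOn_nat_one_add
        hcK (.of_forall fun n x hx ↦ ?_) (fun _ ↦ by fun_prop)
      simpa using pow_le_pow_left₀ (norm_nonneg _) (HB x hx) (δ * n + a)
  exact key.hasProdLocallyUniformlyOn.differentiableOn
    (.of_forall fun _ ↦ by simpa [Finset.prod_fn] using
      DifferentiableOn.finsetProd (fun _ _ ↦ by fun_prop)) Metric.isOpen_ball

lemma mdifferentiable_comp_nome {φ : ℂ → ℂ} (hφ : DifferentiableOn ℂ φ (Metric.ball 0 1)) :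
    MDiff fun τ : ℍ => φ (nome τ) := by
  rw [mdifferentiable_iff]
  have h : DifferentiableOn ℂ (fun z : ℂ => φ (Complex.exp (2 * Real.pi * Complex.I * z)))
      {z | 0 < z.im} := by
    refine hφ.comp (by fun_prop) fun z hz => ?_
    rw [mem_ball_zero_iff]
    exact norm_nome_lt_one ⟨z, hz⟩
  refine h.congr fun z hz => ?_
  simp [nome, ofComplex_apply_of_im_pos hz]

lemma mdifferentiable_exp_mul (c : ℂ) : MDiff fun τ : ℍ => Complex.exp (c * τ) := by
  rw [mdifferentiable_iff]
  have h : DifferentiableOn ℂ (fun z : ℂ => Complex.exp (c * z)) {z | 0 < z.im} := by fun_prop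
  refine h.congr fun z hz => ?_
  simp [ofComplex_apply_of_im_pos hz]

lemma MDiff.zpow {f : ℍ → ℂ} (hf : MDiff f) (h0 : ∀ τ, f τ ≠ 0) (k : ℤ) :
    MDiff fun τ => f τ ^ k := by
  rw [mdifferentiable_iff] at hf ⊢
  exact fun z hz => (hf z hz).zpow (.inl (h0 _))

lemma MDiff.finsetProd {ι : Type*} {s : Finset ι} {f : ι → ℍ → ℂ} (hf : ∀ i ∈ s, MDiff (f i)) :
    MDiff fun τ => ∏ i ∈ s, f i τ := by
  simp_rw [mdifferentiable_iff] at hf ⊢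
  exact DifferentiableOn.fun_finsetProd hf

lemma genEtaSqrt_ne_zero {δ g : ℕ} (hg : 0 < g) (hδ : g < δ) (τ : ℍ) : genEtaSqrt δ g τ ≠ 0 :=
  mul_ne_zero (Complex.exp_ne_zero _)
    (tprod_one_sub_pow_mul_add_ne_zero (norm_nome_lt_one τ) (by omega) hg)

lemma mdifferentiable_genEtaSqrt {δ : ℕ} (hδ : 0 < δ) (g : ℕ) : MDiff (genEtaSqrt δ g) :=
  (mdifferentiable_exp_mul _).mul
    (mdifferentiable_comp_nome (differentiableOn_tprod_one_sub_pow_mul_add hδ g))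

lemma genEta_eq {δ : ℕ} (hδ : 0 < δ) (g : ℕ) (τ : ℍ) : genEta δ g τ =
    Complex.exp (2 * Real.pi * Complex.I * ((δ / 2 * P₂ (g / δ) : ℝ) : ℂ) * τ) *
      ((∏' n : ℕ, (1 - nome τ ^ (δ * n + g))) * ∏' n : ℕ, (1 - nome τ ^ (δ * n + (δ - g)))) := by
  rw [genEta, (multipliable_one_sub_pow_mul_add (norm_nome_lt_one τ) hδ g).tprod_mul
    (multipliable_one_sub_pow_mul_add (norm_nome_lt_one τ) hδ (δ - g))]

lemma genEta_ne_zero {δ g : ℕ} (hg : 0 < g) (hδ : g < δ) (τ : ℍ) : genEta δ g τ ≠ 0 := by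
  rw [genEta_eq (by omega)]
  exact mul_ne_zero (Complex.exp_ne_zero _) (mul_ne_zero
    (tprod_one_sub_pow_mul_add_ne_zero (norm_nome_lt_one τ) (by omega) hg)
    (tprod_one_sub_pow_mul_add_ne_zero (norm_nome_lt_one τ) (by omega) (by omega)))

lemma mdifferentiable_genEta {δ : ℕ} (hδ : 0 < δ) (g : ℕ) : MDiff (genEta δ g) := by
  rw [funext (genEta_eq hδ g)]
  exact (mdifferentiable_exp_mul _).mul
    ((mdifferentiable_comp_nome (differentiableOn_tprod_one_sub_pow_mul_add hδ g)).mul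
      (mdifferentiable_comp_nome (differentiableOn_tprod_one_sub_pow_mul_add hδ (δ - g))))

lemma IsGenEtaProduct.mdifferentiable {f : ℍ → ℂ} (hf : IsGenEtaProduct f) : MDiff f := by
  obtain ⟨M, -, k, rfl⟩ := hf
  refine MDiff.finsetProd fun δ _ => MDiff.finsetProd fun g hg => ?_
  obtain ⟨hg, hδ⟩ := Finset.mem_Ioo.1 hg
  split_ifs
  · exact MDiff.zpow (mdifferentiable_genEtaSqrt (by omega) g) (genEtaSqrt_ne_zero hg hδ) _
  · exact MDiff.zpow (mdifferentiable_genEta (by omega) g) (genEta_ne_zero hg hδ) _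

/-! ### Level one, weight zero -/

/-- A holomorphic `SL(2, ℤ)`-invariant function that vanishes at `i∞` is zero. -/
lemma eq_zero_of_SL2Z_invariant {F : ℍ → ℂ} (hF : MDiff F)
    (hinv : ∀ (γ : SL(2, ℤ)) (τ : ℍ), F (γ • τ) = F τ) (hz : IsZeroAtImInfty F) : F = 0 := by
  have hslash (γ : SL(2, ℤ)) : SlashAction.map (0 : ℤ) γ F = F := by
    ext τ
    simpa [ModularForm.SL_slash_apply] using! hinv γ τ
  -- Vanishing at `i∞` gives boundedness there, so `F` is a modular form of weight 0 and level one,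
  -- hence constant; the constant equals its limit `0`.
  let φ : ModularForm 𝒮ℒ 0 :=
    { toFun := F
      slash_action_eq' := by
        rintro _ ⟨γ, rfl⟩
        exact hslash γ
      holo' := hF
      bdd_at_cusps' := fun hc => by
        rw [OnePoint.isBoundedAt_iff_forall_SL2Z hc]
        intro γ _
        rw [hslash]
        exact hz.isBoundedAtImInfty }
  obtain ⟨c, hc⟩ := ModularFormClass.levelOne_weight_zero_const φ
  have hc' : F = Function.const ℍ c := hc
  have h0 : c = 0 := by
    rw [hc'] at hz
    exact tendsto_nhds_unique tendsto_const_nhds hz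
  rw [hc', h0, Function.const_zero]

/-! ### The group `±Γ`, cusps and fan widths -/

/-- The subgroup `±Γ` of `SL(2, ℤ)`. -/
def plusMinus (Γ : Subgroup SL(2, ℤ)) : Subgroup SL(2, ℤ) where
  carrier := {γ | γ ∈ Γ ∨ -γ ∈ Γ}
  one_mem' := .inl Γ.one_mem
  mul_mem' := by
    rintro a b (ha | ha) (hb | hb)
    · exact .inl (Γ.mul_mem ha hb)
    · exact .inr (by simpa using Γ.mul_mem ha hb)
    · exact .inr (by simpa using Γ.mul_mem ha hb)
    · exact .inl (by simpa using Γ.mul_mem ha hb)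
  inv_mem' := by
    rintro a (ha | ha)
    · exact .inl (Γ.inv_mem ha)
    · refine .inr ?_
      have h : (-a)⁻¹ = -a⁻¹ := inv_eq_of_mul_eq_one_right (by simp)
      simpa [h] using Γ.inv_mem ha

lemma mem_plusMinus {Γ : Subgroup SL(2, ℤ)} {γ : SL(2, ℤ)} :
    γ ∈ plusMinus Γ ↔ γ ∈ Γ ∨ -γ ∈ Γ := Iff.rfl

lemma le_plusMinus (Γ : Subgroup SL(2, ℤ)) : Γ ≤ plusMinus Γ := fun _ => .inl

lemma mapGL_neg_smul (γ : SL(2, ℤ)) (c : OnePoint ℚ) :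
    mapGL ℚ (-γ) • c = mapGL ℚ γ • c := by
  cases c with
  | infty => simp [OnePoint.smul_infty_eq_ite, neg_div_neg_eq]
  | coe x =>
    rw [OnePoint.smul_some_eq_ite, OnePoint.smul_some_eq_ite]
    simp [← neg_add, -neg_add_rev, neg_div_neg_eq]

lemma cuspEquiv_iff_plusMinus {Γ : Subgroup SL(2, ℤ)} {s t : OnePoint ℚ} :
    CuspEquiv Γ s t ↔ ∃ γ ∈ plusMinus Γ, mapGL ℚ γ • s = t := by
  constructor
  · rintro ⟨γ, hγ, h⟩
    exact ⟨γ, .inl hγ, h⟩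
  · rintro ⟨γ, hγ | hγ, h⟩
    · exact ⟨γ, hγ, h⟩
    · exact ⟨-γ, hγ, by rwa [mapGL_neg_smul]⟩

lemma CuspEquiv.refl (Γ : Subgroup SL(2, ℤ)) (s : OnePoint ℚ) : CuspEquiv Γ s s :=
  ⟨1, Γ.one_mem, by simp⟩

lemma CuspEquiv.symm {Γ : Subgroup SL(2, ℤ)} {s t : OnePoint ℚ} (h : CuspEquiv Γ s t) :
    CuspEquiv Γ t s := by
  obtain ⟨γ, hγ, rfl⟩ := h
  exact ⟨γ⁻¹, Γ.inv_mem hγ, by simp⟩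

lemma CuspEquiv.trans {Γ : Subgroup SL(2, ℤ)} {s t u : OnePoint ℚ} (h : CuspEquiv Γ s t)
    (h' : CuspEquiv Γ t u) : CuspEquiv Γ s u := by
  obtain ⟨γ, hγ, rfl⟩ := h
  obtain ⟨γ', hγ', rfl⟩ := h'
  exact ⟨γ' * γ, Γ.mul_mem hγ' hγ, by simp [mul_smul]⟩

lemma mapGL_T_zpow_smul_infty (j : ℤ) : mapGL ℚ (T ^ j) • (OnePoint.infty : OnePoint ℚ) =
    OnePoint.infty := by
  rw [OnePoint.smul_infty_eq_self_iff]
  have h : (T ^ j : SL(2, ℤ)) 1 0 = 0 := by simp [ModularGroup.coe_T_zpow]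
  change (((T ^ j : SL(2, ℤ)) 1 0 : ℤ) : ℚ) = 0
  rw [h, Int.cast_zero]

lemma exists_eq_T_zpow_of_smul_infty {γ : SL(2, ℤ)}
    (h : mapGL ℚ γ • (OnePoint.infty : OnePoint ℚ) = OnePoint.infty) :
    ∃ j : ℤ, γ = T ^ j ∨ -γ = T ^ j := by
  rw [OnePoint.smul_infty_eq_self_iff] at h
  have hc : γ 1 0 = 0 := by simpa using h
  have hdet := Matrix.det_fin_two γ.1
  rw [γ.2, hc, mul_zero, sub_zero] at hdet
  rcases Int.eq_one_or_neg_one_of_mul_eq_one hdet.symm with ha | ha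
  · have hd : γ 1 1 = 1 := by simpa [ha] using hdet.symm
    refine ⟨γ 0 1, .inl ?_⟩
    ext i k
    fin_cases i <;> fin_cases k <;> simp [ModularGroup.coe_T_zpow, ha, hc, hd]
  · have hd : γ 1 1 = -1 := by rw [ha] at hdet; linarith
    refine ⟨-γ 0 1, .inr ?_⟩
    ext i k
    fin_cases i <;> fin_cases k <;> simp [ModularGroup.coe_T_zpow, ha, hc, hd]

lemma mapGL_cuspMatrix_smul_infty (s : OnePoint ℚ) :
    mapGL ℚ (cuspMatrix s) • (OnePoint.infty : OnePoint ℚ) = s :=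
  (s.exists_mem_SL2 ℤ).choose_spec

section FanWidth

variable (Γ : Subgroup SL(2, ℤ)) [Γ.FiniteIndex] (A : SL(2, ℤ))

lemma fanWidth_spec : 0 < fanWidth Γ A ∧ A * T ^ fanWidth Γ A * A⁻¹ ∈ plusMinus Γ := by
  refine Nat.sInf_mem (s := {h : ℕ | 0 < h ∧
    (A * ModularGroup.T ^ h * A⁻¹ ∈ Γ ∨ -(A * ModularGroup.T ^ h * A⁻¹) ∈ Γ)}) ?_
  obtain ⟨n, hn, -, h⟩ := Subgroup.exists_pow_mem_of_index_ne_zero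
    (Subgroup.FiniteIndex.index_ne_zero (H := Γ)) (A * T * A⁻¹)
  exact ⟨n, hn, .inl (by rwa [conj_pow] at h)⟩

lemma fanWidth_pos : 0 < fanWidth Γ A := (fanWidth_spec Γ A).1

/-- The admissible `j` form a subgroup of `ℤ`, generated by its least positive element, which is the
fan width. -/
lemma conj_T_zpow_mem_iff (j : ℤ) :
    A * T ^ j * A⁻¹ ∈ plusMinus Γ ↔ (fanWidth Γ A : ℤ) ∣ j := by
  obtain ⟨h0, h1⟩ := fanWidth_spec Γ A
  rw [← conj_pow] at h1
  rw [← conj_zpow]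
  have hdvd : ∀ i : ℤ, (fanWidth Γ A : ℤ) ∣ i → (A * T * A⁻¹) ^ i ∈ plusMinus Γ := by
    rintro _ ⟨i, rfl⟩
    rw [zpow_mul, zpow_natCast]
    exact Subgroup.zpow_mem _ h1 i
  refine ⟨fun h => ?_, hdvd j⟩
  have hpos : (0 : ℤ) < fanWidth Γ A := by exact_mod_cast h0
  have hmod : (A * T * A⁻¹) ^ (j % fanWidth Γ A) ∈ plusMinus Γ := by
    rw [Int.emod_def, zpow_sub]
    exact Subgroup.mul_mem _ h (Subgroup.inv_mem _ (hdvd _ (dvd_mul_right _ _)))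
  obtain ⟨r, hr⟩ := Int.eq_ofNat_of_zero_le (Int.emod_nonneg j hpos.ne')
  rw [hr, zpow_natCast, conj_pow] at hmod
  have hlt := Int.emod_lt_of_pos j hpos
  by_contra hj
  have hr0 : 0 < r := by
    rcases Nat.eq_zero_or_pos r with rfl | hr0
    · exact absurd (Int.dvd_of_emod_eq_zero (by simpa using hr)) hj
    · exact hr0
  have hle : fanWidth Γ A ≤ r := Nat.sInf_le ⟨hr0, hmod⟩
  omega

end FanWidth

instance (Γ : Subgroup SL(2, ℤ)) [Γ.FiniteIndex] : (plusMinus Γ).FiniteIndex :=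
  Subgroup.finiteIndex_of_le (le_plusMinus Γ)

/-- The cosets `T⁻ʲ A_s⁻¹ (±Γ)`, where `A_s ∞` runs through inequivalent cusps and `j` through the
residues modulo the fan width, exhaust `SL(2, ℤ) / ±Γ` without repetition. -/
lemma bijective_cusp_cosets (Γ : Subgroup SL(2, ℤ)) [Γ.FiniteIndex] {S : Finset (OnePoint ℚ)}
    (hS : IsCompleteSetOfCusps Γ S) (A : OnePoint ℚ → SL(2, ℤ))
    (hA : ∀ s, CuspEquiv Γ (mapGL ℚ (A s) • OnePoint.infty) s) :
    Function.Bijective fun x : (Σ s : S, Fin (fanWidth Γ (A s))) =>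
      (((A x.1 * T ^ (x.2 : ℤ))⁻¹ : SL(2, ℤ)) : SL(2, ℤ) ⧸ plusMinus Γ) := by
  constructor
  · rintro ⟨⟨s, hs⟩, i⟩ ⟨⟨t, ht⟩, j⟩ h
    have hmem : A s * T ^ (i : ℤ) * (A t * T ^ (j : ℤ))⁻¹ ∈ plusMinus Γ := by
      simpa [QuotientGroup.eq] using QuotientGroup.eq.1 h
    have hst : CuspEquiv Γ t s := by
      refine ((hA t).symm.trans (cuspEquiv_iff_plusMinus.2 ⟨_, hmem, ?_⟩)).trans (hA s)
      have hAt : mapGL ℚ (A t) • (OnePoint.infty : OnePoint ℚ) =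
          mapGL ℚ (A t * T ^ (j : ℤ)) • OnePoint.infty := by
        rw [map_mul, mul_smul, mapGL_T_zpow_smul_infty]
      rw [hAt, ← mul_smul, ← map_mul, inv_mul_cancel_right, map_mul, mul_smul,
        mapGL_T_zpow_smul_infty]
    obtain rfl : t = s := (hS t).unique ⟨ht, CuspEquiv.refl Γ t⟩ ⟨hs, hst⟩
    have hmem' : A t * T ^ ((i : ℤ) - j) * (A t)⁻¹ ∈ plusMinus Γ := by
      rw [zpow_sub]
      simpa [mul_assoc] using hmem
    rw [conj_T_zpow_mem_iff] at hmem'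
    have hij : (i : ℤ) = j := by
      have hi : (i : ℕ) < fanWidth Γ (A t) := i.2
      have hj : (j : ℕ) < fanWidth Γ (A t) := j.2
      have := Int.eq_zero_of_abs_lt_dvd hmem' (by rw [abs_lt]; constructor <;> omega)
      omega
    obtain rfl : i = j := Fin.ext (by exact_mod_cast hij)
    rfl
  · intro q
    obtain ⟨x, rfl⟩ := QuotientGroup.mk_surjective q
    obtain ⟨s, ⟨hs, hxs⟩, -⟩ := hS (mapGL ℚ x⁻¹ • OnePoint.infty)
    obtain ⟨γ, hγ, hγs⟩ := cuspEquiv_iff_plusMinus.1 (hxs.trans (hA s).symm)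
    have hfix : mapGL ℚ ((A s)⁻¹ * γ * x⁻¹) • (OnePoint.infty : OnePoint ℚ) = OnePoint.infty := by
      rw [map_mul, map_mul, mul_smul, mul_smul, hγs, ← mul_smul, ← map_mul, inv_mul_cancel, map_one,
        one_smul]
    obtain ⟨j, hj⟩ := exists_eq_T_zpow_of_smul_infty hfix
    -- The sign in the stabilizer of `∞` is absorbed into `γ`, which is why cosets of `±Γ` are used.
    obtain ⟨δ, hδ, hδj⟩ : ∃ δ ∈ plusMinus Γ, (A s)⁻¹ * δ * x⁻¹ = T ^ j := by
      rcases hj with hj | hj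
      · exact ⟨γ, hγ, hj⟩
      · exact ⟨-γ, by simpa [mem_plusMinus, or_comm] using hγ, by simpa using hj⟩
    have hκ : (0 : ℤ) < fanWidth Γ (A s) := by exact_mod_cast fanWidth_pos Γ (A s)
    obtain ⟨r, hr⟩ := Int.eq_ofNat_of_zero_le (Int.emod_nonneg j hκ.ne')
    have hlt := Int.emod_lt_of_pos j hκ
    have hrκ : r < fanWidth Γ (A s) := by omega
    refine ⟨⟨⟨s, hs⟩, ⟨r, hrκ⟩⟩, QuotientGroup.eq.2 ?_⟩
    -- Replacing `j` by its residue `r` multiplies on the left by an element of `±Γ`.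
    have hx : x = (T ^ j)⁻¹ * (A s)⁻¹ * δ := by rw [← hδj]; group
    have hconj : A s * T ^ ((r : ℤ) - j) * (A s)⁻¹ ∈ plusMinus Γ := by
      rw [conj_T_zpow_mem_iff]
      refine ⟨-(j / fanWidth Γ (A s)), ?_⟩
      have := Int.emod_add_mul_ediv j (fanWidth Γ (A s))
      linarith
    have := (plusMinus Γ).mul_mem hconj hδ
    rw [zpow_sub] at this
    simpa [hx, mul_assoc] using this

lemma apply_smul_of_mem_plusMinus {Γ : Subgroup SL(2, ℤ)} {h : ℍ → ℂ}
    (hinv : ∀ γ ∈ Γ, ∀ τ : ℍ, h (γ • τ) = h τ) {γ : SL(2, ℤ)} (hγ : γ ∈ plusMinus Γ) (τ : ℍ) :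
    h (γ • τ) = h τ := by
  rcases hγ with hγ | hγ
  · exact hinv γ hγ τ
  · rw [← ModularGroup.SL_neg_smul, hinv _ hγ]

/-! ### Growth at the cusps -/

section Expansion

variable (Γ : Subgroup SL(2, ℤ)) [Γ.FiniteIndex] {h : ℍ → ℂ}

lemma expansionAt_qParam (hinv : ∀ γ ∈ Γ, ∀ τ : ℍ, h (γ • τ) = h τ) (A : SL(2, ℤ)) (τ : ℍ) :
    expansionAt Γ h A (qParam (fanWidth Γ A) τ) = h (A • τ) := by
  have hper : Function.Periodic (fun z : ℂ => h (A • ofComplex z)) ((fanWidth Γ A : ℝ) : ℂ) := by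
    intro z
    by_cases hz : 0 < z.im
    · have hz' : 0 < (z + ((fanWidth Γ A : ℝ) : ℂ)).im := by simpa using hz
      have htr : ofComplex (z + ((fanWidth Γ A : ℝ) : ℂ)) =
          (T ^ (fanWidth Γ A : ℤ)) • ofComplex z := by
        rw [modular_T_zpow_smul]
        rw [ofComplex_apply_of_im_pos hz, ofComplex_apply_of_im_pos hz']
        ext
        simp [add_comm]
      have hmem := (fanWidth_spec Γ A).2
      have := apply_smul_of_mem_plusMinus hinv hmem (A • ofComplex z)
      simp only [htr]
      rw [← this, ← mul_smul, ← mul_smul, zpow_natCast, inv_mul_cancel_right]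
    -- Off the upper half plane `ofComplex` takes a constant default value, so periodicity is
    -- automatic.
    · have hz' : ¬ 0 < (z + ((fanWidth Γ A : ℝ) : ℂ)).im := by simpa using hz
      simp only [ofComplex_apply_of_im_nonpos (not_lt.1 hz),
        ofComplex_apply_of_im_nonpos (not_lt.1 hz')]
  have hne : ((fanWidth Γ A : ℕ) : ℝ) ≠ 0 := by exact_mod_cast (fanWidth_pos Γ A).ne'
  simpa [expansionAt] using Function.Periodic.eq_cuspFunction hne hper (τ : ℂ)

/-- Translation by `T ^ j` changes only the real part, so it leaves the modulus of the local
parameter unchanged. -/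
lemma isBigO_smul_of_expansionAt (hinv : ∀ γ ∈ Γ, ∀ τ : ℍ, h (γ • τ) = h τ) (A : SL(2, ℤ)) {m : ℤ}
    (hm : expansionAt Γ h A =O[𝓝[≠] 0] fun z => z ^ m) (j : ℤ) :
    (fun τ : ℍ => h ((A * T ^ j) • τ)) =O[atImInfty]
      fun τ => Real.exp (-2 * Real.pi * τ.im / fanWidth Γ A) ^ m := by
  have hκ : (0 : ℝ) < fanWidth Γ A := by exact_mod_cast fanWidth_pos Γ A
  have hT : Tendsto (fun τ : ℍ => T ^ j • τ) atImInfty atImInfty := by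
    simp_rw [modular_T_zpow_smul]
    refine tendsto_comap_iff.2 ?_
    simpa [Function.comp_def] using! tendsto_comap (f := im) (x := (atTop : Filter ℝ))
  have h1 := (hm.comp_tendsto <| tendsto_nhdsWithin_of_tendsto_nhds_of_eventually_within _
    (qParam_tendsto_atImInfty hκ) (.of_forall fun τ => Function.Periodic.qParam_ne_zero _)).comp_tendsto
      hT
  refine (h1.congr_left fun τ => ?_).trans (.of_norm_right ?_)
  · simp [Function.comp_def, expansionAt_qParam Γ hinv, mul_smul]
  · refine IsBigO.of_norm_right (.of_norm_left ?_)
    simp only [Function.comp_def, norm_zpow, Function.Periodic.norm_qParam, Real.norm_eq_abs,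
      Real.abs_exp, modular_T_zpow_smul, coe_im, vadd_im]
    exact isBigO_refl _ _

end Expansion

/-! ### The valence inequality -/

/-- The valence inequality: a holomorphic `Γ`-invariant function on the upper half plane whose
orders at the cusps have positive sum is zero. -/
theorem eq_zero_of_sum_order_pos (Γ : Subgroup SL(2, ℤ)) [Γ.FiniteIndex]
    {S : Finset (OnePoint ℚ)} (hS : IsCompleteSetOfCusps Γ S) (A : OnePoint ℚ → SL(2, ℤ))
    (hA : ∀ s, CuspEquiv Γ (mapGL ℚ (A s) • OnePoint.infty) s) {h : ℍ → ℂ} (hh : MDiff h)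
    (hinv : ∀ γ ∈ Γ, ∀ τ : ℍ, h (γ • τ) = h τ) (m : OnePoint ℚ → ℤ)
    (hm : ∀ s ∈ S, expansionAt Γ h (A s) =O[𝓝[≠] 0] fun z => z ^ m s)
    (hpos : 0 < ∑ s ∈ S, m s) : h = 0 := by
  classical
  let Q := SL(2, ℤ) ⧸ plusMinus Γ
  have : Fintype Q := Fintype.ofFinite Q
  let P : Q → ℍ → ℂ := fun q τ => h (q.out⁻¹ • τ)
  -- By `±Γ`-invariance of `h`, the translate depends only on the coset.
  have hP (x : SL(2, ℤ)) (τ : ℍ) : P (x : Q) τ = h (x⁻¹ • τ) := by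
    obtain ⟨y, hy⟩ := QuotientGroup.mk_out_eq_mul (plusMinus Γ) x
    change h ((x : Q).out⁻¹ • τ) = _
    rw [hy, mul_inv_rev, mul_smul]
    exact apply_smul_of_mem_plusMinus hinv (inv_mem y.2) _
  have hPdiff (q : Q) : MDiff (P q) := by
    have := UpperHalfPlane.mdifferentiable_smul
      (g := (Matrix.SpecialLinearGroup.mapGL ℝ q.out⁻¹)) (by simp)
    exact hh.comp this
  have hsmul (γ : SL(2, ℤ)) (q : Q) (τ : ℍ) : P q (γ • τ) = P (γ⁻¹ • q) τ := by
    obtain ⟨x, rfl⟩ := QuotientGroup.mk_surjective q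
    rw [MulAction.Quotient.smul_mk]
    change P (x : Q) _ = P ((γ⁻¹ • x : SL(2, ℤ)) : Q) _
    rw [hP, hP, ← mul_smul, smul_eq_mul, mul_inv_rev, inv_inv]
  let F : ℍ → ℂ := fun τ => ∏ q : Q, P q τ
  -- `γ` merely permutes the factors.
  have hFinv (γ : SL(2, ℤ)) (τ : ℍ) : F (γ • τ) = F τ := by
    simp only [F, hsmul]
    exact Equiv.prod_comp (MulAction.toPerm γ⁻¹ : Equiv.Perm Q) fun q => P q τ
  have hFeq (τ : ℍ) : F τ = ∏ s : S, ∏ j : Fin (fanWidth Γ (A s)), h ((A s * T ^ (j : ℤ)) • τ) := by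
    rw [← Fintype.prod_sigma']
    refine ((bijective_cusp_cosets Γ hS A hA).prod_comp fun q => P q τ).symm.trans ?_
    simp only [hP, inv_inv]
  have hO : F =O[atImInfty] fun τ => 
      Real.exp ((∑ s ∈ S, m s : ℤ) * (-2 * Real.pi * τ.im)) := by
    have h1 : F =O[atImInfty] fun τ => ∏ s : S, ∏ _j : Fin (fanWidth Γ (A s)),
        Real.exp (-2 * Real.pi * τ.im / fanWidth Γ (A s)) ^ m s := by
      rw [funext hFeq]
      exact .finsetProd fun s _ => .finsetProd fun j _ =>
        isBigO_smul_of_expansionAt Γ hinv (A s) (hm s s.2) j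
    refine h1.congr_right fun τ => ?_
    -- The `κ` equal factors at a cusp cancel the `1 / κ` in the exponent.
    have h2 (s : S) : ∏ _j : Fin (fanWidth Γ (A s)),
        Real.exp (-2 * Real.pi * τ.im / fanWidth Γ (A s)) ^ m s =
          Real.exp (m s * (-2 * Real.pi * τ.im)) := by
      have hκ : (fanWidth Γ (A s) : ℝ) ≠ 0 := by exact_mod_cast (fanWidth_pos Γ (A s)).ne'
      rw [Finset.prod_const, Finset.card_univ, Fintype.card_fin, ← Real.rpow_intCast, ← Real.exp_mul,
        ← Real.exp_nat_mul]
      congr 1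
      field_simp
    simp_rw [h2]
    rw [← Real.exp_sum, ← Finset.sum_mul, Finset.sum_coe_sort S fun s => (m s : ℝ)]
    push_cast
    rfl
  have hzero : IsZeroAtImInfty F := by
    refine hO.trans_tendsto (Real.tendsto_exp_atBot.comp ?_)
    have hneg : (((∑ s ∈ S, m s : ℤ) : ℝ)) * (-2 * Real.pi) < 0 :=
      mul_neg_of_pos_of_neg (by exact_mod_cast hpos) (by linarith [Real.pi_pos])
    simpa [mul_assoc] using! (tendsto_comap (f := im) (x := (atTop : Filter ℝ))).const_mul_atTop_of_neg
      hneg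
  have hF0 : F = 0 := eq_zero_of_SL2Z_invariant (MDiff.finsetProd fun q _ => hPdiff q) hFinv hzero
  have hprod : ∏ q : Q, P q = 0 := by
    rw [← hF0]
    ext τ
    simp [F]
  -- Holomorphic functions on the connected `ℍ` have no zero divisors.
  obtain ⟨q, -, hq⟩ := (UpperHalfPlane.prod_eq_zero_iff fun q _ => hPdiff q).1 hprod
  ext τ
  simpa [P] using congrFun hq (q.out • τ)

/-! ### Orders of linear combinations and the criterion -/

/-- After multiplication by `z ^ (-m)` the order is nonnegative, so a finite limit exists at `0`.
Growth bounds also cover order `⊤` uniformly. -/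
lemma isBigO_zpow_of_le_meromorphicOrderAt {φ : ℂ → ℂ} (hφ : MeromorphicAt φ 0) {m : ℤ}
    (hm : (m : WithTop ℤ) ≤ meromorphicOrderAt φ 0) : φ =O[𝓝[≠] 0] fun z => z ^ m := by
  have hmer : MeromorphicAt (fun z : ℂ => z ^ (-m) * φ z) 0 := by fun_prop
  have hord : 0 ≤ meromorphicOrderAt (fun z : ℂ => z ^ (-m) * φ z) 0 := by
    have h1 : MeromorphicAt (fun z : ℂ => z ^ (-m)) 0 := by fun_prop
    have h2 : meromorphicOrderAt (fun z : ℂ => z ^ (-m)) 0 = ((-m : ℤ) : WithTop ℤ) := by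
      rw [meromorphicOrderAt_eq_int_iff h1]
      exact ⟨fun _ => 1, analyticAt_const, one_ne_zero, by simp⟩
    have h3 := meromorphicOrderAt_mul h1 hφ
    simp only [Pi.mul_def] at h3
    rw [h3, h2]
    calc (0 : WithTop ℤ) = ((-m : ℤ) : WithTop ℤ) + (m : WithTop ℤ) := by
          rw [← WithTop.coe_add]; simp
      _ ≤ _ := by gcongr
  obtain ⟨c, hc⟩ := tendsto_nhds_of_meromorphicOrderAt_nonneg hmer hord
  refine ((isBigO_refl (fun z : ℂ => z ^ m) (𝓝[≠] 0)).mul (hc.isBigO_one ℂ)).congr' ?_ (by simp)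
  filter_upwards [self_mem_nhdsWithin] with z hz
  have hz0 : z ≠ 0 := hz
  rw [← mul_assoc, ← zpow_add₀ hz0]
  simp

section LinearCombination

variable {ι : Type*} [Fintype ι] {f : ι → ℍ → ℂ} {α : ι → ℂ} {g : ℍ → ℂ}

lemma expansionAt_linearCombination (Γ : Subgroup SL(2, ℤ)) (A : SL(2, ℤ))
    (hg : ∀ τ, g τ = (∑ j, α j * f j τ) + 1) :
    expansionAt Γ g A =ᶠ[𝓝[≠] 0] fun q => (∑ j, α j * expansionAt Γ (f j) A q) + 1 := by
  filter_upwards [self_mem_nhdsWithin] with q hq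
  simp only [expansionAt, Function.Periodic.cuspFunction_eq_of_nonzero _ _ hq, hg]

/-- The condition `m ≤ 0` is what lets the constant `1` satisfy the bound. -/
lemma isBigO_expansionAt_linearCombination {Γ : Subgroup SL(2, ℤ)} {A : SL(2, ℤ)}
    (hg : ∀ τ, g τ = (∑ j, α j * f j τ) + 1) {m : ℤ} (hm : m ≤ 0)
    (hf : ∀ j, expansionAt Γ (f j) A =O[𝓝[≠] 0] fun z => z ^ m) :
    expansionAt Γ g A =O[𝓝[≠] 0] fun z => z ^ m := by
  refine IsBigO.congr' (.add (.fun_sum fun j _ => (hf j).const_mul_left (α j)) ?_)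
    (expansionAt_linearCombination Γ A hg).symm .rfl
  refine isBigO_zpow_of_le_meromorphicOrderAt (MeromorphicAt.const 1 0) ?_
  rw [meromorphicOrderAt_const, if_neg one_ne_zero]
  exact_mod_cast hm

end LinearCombination

lemma ORD_eq_top (Γ : Subgroup SL(2, ℤ)) (s : OnePoint ℚ) {g : ℍ → ℂ} (hg : ∀ τ, g τ = 0) :
    ORD g s Γ = ⊤ := by
  refine meromorphicOrderAt_eq_top_iff.2 ?_
  filter_upwards [self_mem_nhdsWithin] with q hq
  simp only [expansionAt, Function.Periodic.cuspFunction_eq_of_nonzero _ _ hq, hg]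

/-- For a finite index subgroup `Γ`, a function `∑ j, α j * f j + 1` with the `f j` holomorphic on
`ℍ` and modular on `Γ` vanishes if and only if its order at `∞` exceeds `-B`. -/
theorem linearCombination_eq_zero_iff (Γ : Subgroup SL(2, ℤ)) [Γ.FiniteIndex]
    {S : Finset (OnePoint ℚ)} (hS : IsCompleteSetOfCusps Γ S) {n : ℕ} {f : Fin n → ℍ → ℂ}
    (hf : ∀ j, MDiff (f j)) (hmod : ∀ j, IsModularFunction Γ (f j)) {α : Fin n → ℂ} {g : ℍ → ℂ}
    (hg : ∀ τ, g τ = (∑ j, α j * f j τ) + 1) :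
    (∀ τ, g τ = 0) ↔ ORD g OnePoint.infty Γ > ((-boundB Γ S f : ℤ) : WithTop ℤ) := by
  classical
  refine ⟨fun h => ?_, fun hord => ?_⟩
  · rw [ORD_eq_top Γ _ h]
    exact WithTop.coe_lt_top _
  -- The representative of `∞` in `S` need not be `∞` itself, while the hypothesis on `g` uses the
  -- expansion at `∞`; there the matrix is changed accordingly.
  let A : OnePoint ℚ → SL(2, ℤ) := fun s =>
    if CuspEquiv Γ s OnePoint.infty then cuspMatrix OnePoint.infty else cuspMatrix s
  let μ : OnePoint ℚ → ℤ := fun s => (min (Finset.univ.inf fun j => ORD (f j) s Γ) 0).untopD 0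
  -- An integral order greater than `-B` is at least `-B + 1`, so the bounds sum to exactly `1`.
  let m : OnePoint ℚ → ℤ := fun s =>
    if CuspEquiv Γ s OnePoint.infty then -boundB Γ S f + 1 else μ s
  have hA (s : OnePoint ℚ) :
      CuspEquiv Γ (Matrix.SpecialLinearGroup.mapGL ℚ (A s) • OnePoint.infty) s := by
    by_cases h : CuspEquiv Γ s OnePoint.infty
    · simpa only [A, if_pos h, mapGL_cuspMatrix_smul_infty] using h.symm
    · simpa only [A, if_neg h, mapGL_cuspMatrix_smul_infty] using CuspEquiv.refl Γ s
  have hgdiff : MDiff g := by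
    have hsum : MDiff fun τ => (∑ j, α j * f j τ) + 1 := by
      have hf' (j : Fin n) := UpperHalfPlane.mdifferentiable_iff.1 (hf j)
      rw [UpperHalfPlane.mdifferentiable_iff]
      exact (DifferentiableOn.fun_sum fun j _ => (hf' j).const_mul (α j)).add_const 1
    rwa [funext hg]
  have hginv : ∀ γ ∈ Γ, ∀ τ : ℍ, g (γ • τ) = g τ := fun γ hγ τ => by
    simp only [hg, (hmod _).invariant γ hγ]
  -- The minimum is at most `0`, hence finite, and the default value of `untopD` is never used.
  have hμ (s : OnePoint ℚ) : (μ s : WithTop ℤ) = min (Finset.univ.inf fun j => ORD (f j) s Γ) 0 := by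
    obtain ⟨k, hk⟩ := WithTop.ne_top_iff_exists.1
      (ne_top_of_le_ne_top WithTop.zero_ne_top
        (min_le_right (Finset.univ.inf fun j => ORD (f j) s Γ) 0))
    simp [μ, ← hk]
  have hO (s : OnePoint ℚ) (_ : s ∈ S) : expansionAt Γ g (A s) =O[𝓝[≠] 0] fun z => z ^ m s := by
    by_cases h : CuspEquiv Γ s OnePoint.infty
    · simp only [A, m, if_pos h]
      refine isBigO_zpow_of_le_meromorphicOrderAt ?_ ?_
      · refine MeromorphicAt.congr ?_ (expansionAt_linearCombination Γ _ hg).symm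
        exact (MeromorphicAt.fun_sum fun j _ =>
          (MeromorphicAt.const (α j) 0).fun_mul ((hmod j).meromorphicAtCusps _)).fun_add
            (MeromorphicAt.const 1 0)
      · change _ ≤ ORD g OnePoint.infty Γ
        cases hk : ORD g OnePoint.infty Γ with
        | top => exact le_top
        | coe k =>
          rw [hk, gt_iff_lt, WithTop.coe_lt_coe] at hord
          exact WithTop.coe_le_coe.2 hord
    · simp only [A, m, if_neg h]
      refine isBigO_expansionAt_linearCombination hg ?_ fun j =>
        isBigO_zpow_of_le_meromorphicOrderAt ((hmod j).meromorphicAtCusps _) ?_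
      · exact_mod_cast (hμ s).trans_le (min_le_right _ _)
      · rw [hμ]
        exact (min_le_left _ _).trans (Finset.inf_le (Finset.mem_univ j))
  have hsum : ∑ s ∈ S, m s = 1 := by
    obtain ⟨s₀, ⟨hs₀, hs₀'⟩, huniq⟩ := hS OnePoint.infty
    have hfilter : {s ∈ S | CuspEquiv Γ s OnePoint.infty} = {s₀} := by
      ext s
      simp only [Finset.mem_filter, Finset.mem_singleton]
      exact ⟨fun h => huniq s ⟨h.1, h.2.symm⟩, fun h => h ▸ ⟨hs₀, hs₀'.symm⟩⟩
    have hB : boundB Γ S f = ∑ s ∈ S with ¬ CuspEquiv Γ s OnePoint.infty, μ s := by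
      simp only [boundB, μ]
    simp only [m]
    rw [Finset.sum_ite, Finset.sum_const, hfilter, Finset.card_singleton, ← hB]
    simp
  intro τ
  exact congrFun (eq_zero_of_sum_order_pos Γ hS A hA hgdiff hginv m hO (by omega)) τ

end GenEta

theorem mainTheorem1 (N : ℕ) (hN : 0 < N) (S : Finset (OnePoint ℚ))
    (hS : GenEta.IsCompleteSetOfCusps (CongruenceSubgroup.Gamma1 N) S)
    (n : ℕ) (f : Fin n → UpperHalfPlane → ℂ)
    (hf : ∀ j, GenEta.IsGenEtaProduct (f j))
    (hmod : ∀ j, GenEta.IsModularFunction (CongruenceSubgroup.Gamma1 N) (f j))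
    (α : Fin n → ℂ) (g : UpperHalfPlane → ℂ)
    (hg : ∀ τ, g τ = (∑ j, α j * f j τ) + 1) :
    (∀ τ, g τ = 0) ↔
      GenEta.ORD g OnePoint.infty (CongruenceSubgroup.Gamma1 N) >
        ((-GenEta.boundB (CongruenceSubgroup.Gamma1 N) S f : ℤ) : WithTop ℤ) := by
  have : NeZero N := ⟨hN.ne'⟩
  exact GenEta.linearCombination_eq_zero_iff _ hS (fun j => (hf j).mdifferentiable) hmod hg
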